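/- Let $r\ge 1$, let $\overline n=(n_1,\dots,n_r)$ be integers with $0\le n_1\le n_2\le\cdots\le n_r$, and let $t$ be a positive integer or $t=\infty$. Let $\mathbb Z_t\subseteq S^1\subset\mathbb C$ be the group of $t$-th roots of unity if $t<\infty$, and $\mathbb Z_\infty=S^1$. Let $\mathbb{C}\mathrm{P}_{\overline n}(t)$ be the quotient of $S^{2n_1+1}\times\cdots\times S^{2n_r+1}$, where $S^{2m+1}$ is the unit sphere of $\mathbb C^{m+1}$, by the diagonal action $\lambda\cdot(x_1,\dots,x_r)=(\lambda x_1,\dots,\lambda x_r)$ of $\mathbb Z_t$; in particular $\mathbb{C}\mathrm{P}_{(n_1)}(t)=S^{2n_1+1}/\mathbb Z_t$. For a space $X$, let $\mathrm{TC}(X)$ be Farber's (reduced) topological complexity, the least $k\ge 0$ such that $X\times X$ has a cover by $k+1$ open sets on each of which the evaluation map $X^{[0,1]}\to X\times X$, $\gamma\mapsto(\gamma(0),\gamma(1))$, has a continuous section; and let $\mathrm{cat}(X)$ be the (reduced) Lusternik–Schnirelmann category, the least $k\ge 0$ such that $X$ has a cover by $k+1$ open sets each contractible in $X$ (both are $\infty$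 if there is no such $k$). Then $\mathrm{TC}(\mathbb{C}\mathrm{P}_{(n_1)}(t))$ and $\mathrm{cat}(\mathbb{C}\mathrm{P}_{(n_1)}(t))$ are finite, and $$\mathrm{TC}(\mathbb{C}\mathrm{P}_{\overline n}(t))\le r\bigl(1+\mathrm{TC}(\mathbb{C}\mathrm{P}_{(n_1)}(t))\bigr)-1 .$$ Moreover, this improves the bound $\mathrm{TC}(\mathbb{C}\mathrm{P}_{\overline n}(t))\le 2r\bigl(\mathrm{cat}(\mathbb{C}\mathrm{P}_{(n_1)}(t))+1\bigr)-2$, obtained from Varadarajan's estimate of the category of the total space of a fibration, by at least $r-1$: $$\Bigl(r\bigl(1+\mathrm{TC}(\mathbb{C}\mathrm{P}_{(n_1)}(t))\bigr)-1\Bigr)+(r-1)\le 2r\bigl(\mathrm{cat}(\mathbb{C}\mathrm{P}_{(n_1)}(t))+1\bigr)-2 .$$ -/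

import Mathlib

open scoped unitInterval

/-- The odd-dimensional sphere `S^{2m+1}`, as the unit sphere of `ℂ^{m+1}`. -/
abbrev OddSphere (m : ℕ) : Type :=
  Metric.sphere (0 : EuclideanSpace ℂ (Fin (m + 1))) 1

/-- `S^1` acts on `S^{2m+1}` by complex multiplication of vectors. -/
instance OddSphere.instMulActionCircle (m : ℕ) : MulAction Circle (OddSphere m) where
  smul z x := ⟨(z : ℂ) • (x : EuclideanSpace ℂ (Fin (m + 1))), by
    have hx : ‖(x : EuclideanSpace ℂ (Fin (m + 1)))‖ = 1 := norm_eq_of_mem_sphere x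
    simp [norm_smul, hx, Circle.norm_coe]⟩
  one_smul x := Subtype.ext (by
    change ((1 : Circle) : ℂ) • (x : EuclideanSpace ℂ (Fin (m + 1))) = x
    simp)
  mul_smul z w x := Subtype.ext (by
    change ((z * w : Circle) : ℂ) • (x : EuclideanSpace ℂ (Fin (m + 1)))
      = (z : ℂ) • ((w : ℂ) • (x : EuclideanSpace ℂ (Fin (m + 1))))
    rw [Circle.coe_mul, mul_smul])

theorem OddSphere.coe_smul {m : ℕ} (z : Circle) (x : OddSphere m) :
    ((z • x : OddSphere m) : EuclideanSpace ℂ (Fin (m + 1)))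
      = (z : ℂ) • (x : EuclideanSpace ℂ (Fin (m + 1))) := rfl

/-- The group `ℤ_t`, as a subgroup of `S^1`: the `t`-th roots of unity for a positive integer `t`,
and all of `S^1` for `t = ∞`. (The value `t = 0` is never used.) -/
noncomputable def torsionCircle : ℕ∞ → Subgroup Circle
  | none => ⊤
  | some k => (powMonoidHom k : Circle →* Circle).ker

theorem mem_torsionCircle_top (z : Circle) : z ∈ torsionCircle ⊤ := Subgroup.mem_top z

theorem mem_torsionCircle_coe (k : ℕ) (z : Circle) :
    z ∈ torsionCircle (k : ℕ∞) ↔ z ^ k = 1 := Iff.rfl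

/-- The product `S^{2n_1+1} × ⋯ × S^{2n_r+1}`. The group `S^1` and its subgroups act on it
diagonally. -/
abbrev OddSphereProduct {r : ℕ} (n : Fin r → ℕ) : Type :=
  (i : Fin r) → OddSphere (n i)

/-- The space `CP_n(t)`, with the quotient topology: the orbit space of
`S^{2n_1+1} × ⋯ × S^{2n_r+1}` under the diagonal action of `ℤ_t`. For finite `t` this is the
`t`-torsion lens product space, for `t = ∞` the complex-projective product space. -/
abbrev CPProduct {r : ℕ} (n : Fin r → ℕ) (t : ℕ∞) : Type :=
  MulAction.orbitRel.Quotient (torsionCircle t) (OddSphereProduct n)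

/-- A set `U` of pairs of points of `X` admits a local motion planner: a continuous map
`s : U → X^[0,1]` (compact-open topology) with `s (a, b)` a path from `a` to `b`. -/
def HasMotionPlanner {X : Type*} [TopologicalSpace X] (U : Set (X × X)) : Prop :=
  ∃ s : C(U, C(I, X)), ∀ p : U, s p 0 = p.1.1 ∧ s p 1 = p.1.2

/-- Farber's topological complexity, reduced: the least `k` such that `X × X` is covered by `k + 1`
open sets admitting local motion planners (`⊤` if there is no such `k`). -/
noncomputable def topComplexity (X : Type*) [TopologicalSpace X] : ℕ∞ :=
  sInf {m : ℕ∞ | ∃ k : ℕ, m = k ∧ ∃ U : Fin (k + 1) → Set (X × X),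
    (∀ i, IsOpen (U i)) ∧ (⋃ i, U i) = Set.univ ∧ ∀ i, HasMotionPlanner (U i)}

/-- `U` is contractible in `X`: the inclusion `U → X` is homotopic to a constant map. -/
def ContractibleIn {X : Type*} [TopologicalSpace X] (U : Set X) : Prop :=
  (⟨Subtype.val, continuous_subtype_val⟩ : C(U, X)).Nullhomotopic

/-- The Lusternik-Schnirelmann category, reduced: the least `k` such that `X` is covered by `k + 1`
open sets that are contractible in `X` (`⊤` if there is no such `k`). -/
noncomputable def lsCategory (X : Type*) [TopologicalSpace X] : ℕ∞ :=
  sInf {m : ℕ∞ | ∃ k : ℕ, m = k ∧ ∃ U : Fin (k + 1) → Set X,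
    (∀ i, IsOpen (U i)) ∧ (⋃ i, U i) = Set.univ ∧ ∀ i, ContractibleIn (U i)}

/-! The space `CP_n(t)` is the total space of a bundle over `B = S^{2n_1+1} / ℤ_t` with fibre
`S^{2n_2+1} × ⋯ × S^{2n_r+1}`, and each motion planner on an open set `V ⊆ B × B` gives rise to `r`
motion planners that cover the preimage of `V`.

Given `[x], [y]` over `V`, the planned path in `B` is lifted, equivariantly and continuously in all
data, to a path in the first sphere from `x 0` to a multiple `θ • y 0` with `θ ∈ ℤ_t`
(`CPProduct.exists_lifted_planner`). Since `[θ • y] = [y]`, it remains to move every other `x j` to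
`θ • y j` inside its sphere by a path that depends on the pair of endpoints continuously and
commutes with the diagonal action. On an odd sphere two open sets of pairs suffice for that
(`OddSphere.plan`): on pairs that are not antipodal the path is the geodesic, and on pairs that are
not equal it is the geodesic to the antipode, rotated by `e^{iπs}`. With `r - 1` spheres this gives
`2 ^ (r - 1)` open sets. They are merged into `r` by the stratification argument for products: the
strata on which the same number of coordinates needs the second planner are pairwise separated, and
so have disjoint open neighbourhoods in a completely normal space (`exists_cover_of_covers`,
`CPProduct.exists_cover_preimage`).

Path lifting rests on a `LocalTransport`, an equivariant rule that moves a point to any nearby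
orbit. For the torsion subgroup of the circle the rule picks the point of the orbit closest in phase
(`CPProduct.nonempty_localTransport`). A path is lifted by iterating the rule over a mesh. The mesh
size depends continuously on the path, by a partition of unity, and the lift is continuous because
a surplus of steps has no effect (`LocalTransport.exists_transport`).

The same rule shows that `B` is locally contractible in itself, so `cat B` is finite by compactness.
The stratification argument, applied to the products `U × U'` of sets contractible in the
path-connected space `B`, gives `TC B ≤ 2 cat B` (`topComplexity_le_two_mul_lsCategory`). This
makes `TC B` finite and is equivalent to the last inequality. -/

open Topology Set

/-! ### Motion planners and open covers -/

section MotionPlanners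

variable {X Y Z : Type*} [TopologicalSpace X] [TopologicalSpace Y] [TopologicalSpace Z]

theorem IsOpenQuotientMap.continuousOn_of_comp {q : X → Y} (hq : IsOpenQuotientMap q) {f : Y → Z}
    {s : Set Y} (h : ContinuousOn (f ∘ q) (q ⁻¹' s)) : ContinuousOn f s := by
  intro y hy
  obtain ⟨x, rfl⟩ := hq.surjective y
  have hmap : Filter.map q (𝓝[q ⁻¹' s] x) = 𝓝[s] (q x) := by
    rw [nhdsWithin, Filter.map_inf_principal_preimage,
      hq.isOpenMap.map_nhds_eq hq.continuous.continuousAt, nhdsWithin]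
  rw [ContinuousWithinAt, ← hmap, Filter.tendsto_map'_iff]
  exact h x hy

theorem hasMotionPlanner_of_continuousOn {U : Set (X × X)} (f : X × X → I → X)
    (hf : ContinuousOn (Function.uncurry f) (U ×ˢ univ))
    (h0 : ∀ p ∈ U, f p 0 = p.1) (h1 : ∀ p ∈ U, f p 1 = p.2) : HasMotionPlanner U := by
  have hc : Continuous fun p : U × I => f p.1 p.2 :=
    hf.comp_continuous (f := fun p : U × I => ((p.1 : X × X), p.2)) (by fun_prop)
      (fun p => ⟨p.1.2, mem_univ _⟩)
  refine ⟨ContinuousMap.curry ⟨_, hc⟩, fun p => ⟨h0 _ p.2, h1 _ p.2⟩⟩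

open Classical in
theorem HasMotionPlanner.exists_continuousOn {U : Set (X × X)} (h : HasMotionPlanner U) :
    ∃ f : X × X → I → X, ContinuousOn (Function.uncurry f) (U ×ˢ univ) ∧
      (∀ p ∈ U, f p 0 = p.1) ∧ ∀ p ∈ U, f p 1 = p.2 := by
  obtain ⟨s, hs⟩ := h
  refine ⟨fun p τ => if hp : p ∈ U then s ⟨p, hp⟩ τ else p.1, ?_, ?_, ?_⟩
  · rw [continuousOn_iff_continuous_domRestrict]
    have hc : Continuous fun p : ↥(U ×ˢ (univ : Set I)) => s ⟨p.1.1, p.2.1⟩ p.1.2 := by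
      fun_prop
    refine hc.congr fun p => ?_
    simp [Function.uncurry, p.2.1]
  · intro p hp
    simp [hp, (hs ⟨p, hp⟩).1]
  · intro p hp
    simp [hp, (hs ⟨p, hp⟩).2]

theorem HasMotionPlanner.mono {U V : Set (X × X)} (h : HasMotionPlanner V) (hUV : U ⊆ V) :
    HasMotionPlanner U := by
  obtain ⟨f, hf, h0, h1⟩ := h.exists_continuousOn
  exact hasMotionPlanner_of_continuousOn f (hf.mono (prod_mono hUV subset_rfl))
    (fun p hp => h0 p (hUV hp)) (fun p hp => h1 p (hUV hp))

open Classical in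
theorem HasMotionPlanner.iUnion {ι : Type*} {U : ι → Set (X × X)} (hU : ∀ i, IsOpen (U i))
    (hd : Pairwise fun i j => Disjoint (U i) (U j)) (h : ∀ i, HasMotionPlanner (U i)) :
    HasMotionPlanner (⋃ i, U i) := by
  choose f hf h0 h1 using fun i => (h i).exists_continuousOn
  let g : X × X → I → X := fun p τ => if hp : ∃ i, p ∈ U i then f hp.choose p τ else p.1
  have hg : ∀ i, ∀ p ∈ U i, g p = f i p := by
    intro i p hp
    have hex : ∃ i, p ∈ U i := ⟨i, hp⟩
    have : hex.choose = i := by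
      by_contra hne
      exact disjoint_left.1 (hd hne) hex.choose_spec hp
    funext τ
    simp only [g, dif_pos hex, this]
  refine hasMotionPlanner_of_continuousOn g ?_ ?_ ?_
  · rw [iUnion_prod_const]
    refine ContinuousOn.iUnion_of_isOpen (fun i => ?_) (fun i => (hU i).prod isOpen_univ)
    refine (hf i).congr fun p hp => ?_
    simp only [Function.uncurry, hg i p.1 hp.1]
  · intro p hp
    obtain ⟨i, hi⟩ := mem_iUnion.1 hp
    rw [hg i p hi, h0 i p hi]
  · intro p hp
    obtain ⟨i, hi⟩ := mem_iUnion.1 hp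
    rw [hg i p hi, h1 i p hi]

theorem topComplexity_le_of_cover {ι : Type*} [Fintype ι] {N : ℕ} (hN : Fintype.card ι = N + 1)
    (U : ι → Set (X × X)) (hU : ∀ i, IsOpen (U i)) (hcov : (⋃ i, U i) = univ)
    (h : ∀ i, HasMotionPlanner (U i)) : topComplexity X ≤ N := by
  let e : Fin (N + 1) ≃ ι := (Fintype.equivFinOfCardEq hN).symm
  refine sInf_le ⟨N, rfl, fun i => U (e i), fun i => hU _, ?_, fun i => h _⟩
  rw [← hcov]
  exact e.surjective.iUnion_comp U

theorem exists_cover_of_topComplexity_eq {N : ℕ} (hN : topComplexity X = N) :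
    ∃ U : Fin (N + 1) → Set (X × X),
      (∀ i, IsOpen (U i)) ∧ (⋃ i, U i) = univ ∧ ∀ i, HasMotionPlanner (U i) := by
  have hne : {m : ℕ∞ | ∃ k : ℕ, m = k ∧ ∃ U : Fin (k + 1) → Set (X × X),
      (∀ i, IsOpen (U i)) ∧ (⋃ i, U i) = univ ∧ ∀ i, HasMotionPlanner (U i)}.Nonempty := by
    by_contra hempty
    rw [topComplexity, not_nonempty_iff_eq_empty.1 hempty, sInf_empty] at hN
    exact ENat.top_ne_natCast N hN
  obtain ⟨k, hk, hcov⟩ := csInf_mem hne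
  have : N = k := by exact_mod_cast hN.symm.trans hk
  subst this
  exact hcov

theorem lsCategory_le_of_cover {ι : Type*} [Fintype ι] {N : ℕ} (hN : Fintype.card ι = N + 1)
    (U : ι → Set X) (hU : ∀ i, IsOpen (U i)) (hcov : (⋃ i, U i) = univ)
    (h : ∀ i, ContractibleIn (U i)) : lsCategory X ≤ N := by
  let e : Fin (N + 1) ≃ ι := (Fintype.equivFinOfCardEq hN).symm
  refine sInf_le ⟨N, rfl, fun i => U (e i), fun i => hU _, ?_, fun i => h _⟩
  rw [← hcov]
  exact e.surjective.iUnion_comp U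

theorem exists_cover_of_lsCategory_eq {N : ℕ} (hN : lsCategory X = N) :
    ∃ U : Fin (N + 1) → Set X,
      (∀ i, IsOpen (U i)) ∧ (⋃ i, U i) = univ ∧ ∀ i, ContractibleIn (U i) := by
  have hne : {m : ℕ∞ | ∃ k : ℕ, m = k ∧ ∃ U : Fin (k + 1) → Set X,
      (∀ i, IsOpen (U i)) ∧ (⋃ i, U i) = univ ∧ ∀ i, ContractibleIn (U i)}.Nonempty := by
    by_contra hempty
    rw [lsCategory, not_nonempty_iff_eq_empty.1 hempty, sInf_empty] at hN
    exact ENat.top_ne_natCast N hN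
  obtain ⟨k, hk, hcov⟩ := csInf_mem hne
  have : N = k := by exact_mod_cast hN.symm.trans hk
  subst this
  exact hcov

/-- Finitely many pairwise separated sets in a completely normal space have pairwise disjoint open
neighbourhoods. -/
theorem exists_pairwise_disjoint_isOpen_superset [CompletelyNormalSpace X] {ι : Type*} [Finite ι]
    (P : ι → Set X) (hP : Pairwise fun i j => Disjoint (closure (P i)) (P j)) :
    ∃ O : ι → Set X, (∀ i, IsOpen (O i)) ∧ (∀ i, P i ⊆ O i) ∧
      Pairwise fun i j => Disjoint (O i) (O j) := by
  have hsep : ∀ i j, i ≠ j → SeparatedNhds (P i) (P j) := fun i j hij =>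
    separatedNhds_iff_disjoint.2 (completely_normal (hP hij) (hP hij.symm).symm)
  choose! A B hA hB hPA hPB hAB using hsep
  refine ⟨fun i => ⋂ j, ⋂ _ : i ≠ j, A i j ∩ B j i, fun i => ?_, fun i => ?_, fun i j hij => ?_⟩
  · exact isOpen_iInter_of_finite fun j => isOpen_iInter_of_finite fun hij =>
      (hA i j hij).inter (hB j i hij.symm)
  · exact subset_iInter₂ fun j hij => subset_inter (hPA i j hij) (hPB j i hij.symm)
  · refine (hAB i j hij).mono ?_ ?_
    · exact (iInter₂_subset j hij).trans inter_subset_left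
    · exact (iInter₂_subset i hij.symm).trans inter_subset_right

/-- Given, for each `a` in a finite set, an open cover of `Z` by sets `A a j` with `j ≤ c a`, there
is an open cover of `Z` by sets `O f ⊆ ⋂ a, A a (f a)` such that those `O f` with the same sum of
indices `∑ a, f a` are pairwise disjoint. The set `O f` is a neighbourhood of the stratum of points
for which `f a` is the first index `j` with `z ∈ A a j`. -/
theorem exists_cover_of_covers [CompletelyNormalSpace X] {α : Type*} [Fintype α] (c : α → ℕ)
    {Z : Set X} (hZ : IsOpen Z) (A : (a : α) → Fin (c a + 1) → Set X)
    (hA : ∀ a j, IsOpen (A a j)) (hcov : ∀ a, Z ⊆ ⋃ j, A a j) :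
    ∃ O : ((a : α) → Fin (c a + 1)) → Set X, (∀ f, IsOpen (O f)) ∧ (∀ f, O f ⊆ Z) ∧
      (∀ f a, O f ⊆ A a (f a)) ∧
      (∀ f g, f ≠ g → ∑ a, (f a : ℕ) = ∑ a, (g a : ℕ) → Disjoint (O f) (O g)) ∧
      Z ⊆ ⋃ f, O f := by
  classical
  let P : ((a : α) → Fin (c a + 1)) → Set X := fun f =>
    {z | z ∈ Z ∧ ∀ a, z ∈ A a (f a) ∧ ∀ j < f a, z ∉ A a j}
  have hPsep : ∀ f g, (∃ a, f a < g a) → Disjoint (P f) (closure (P g)) := by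
    rintro f g ⟨a, ha⟩
    refine Disjoint.mono_left (fun z hz => (hz.2 a).1) ?_
    refine Disjoint.closure_right ?_ (hA a (f a))
    exact disjoint_left.2 fun z hz hzg => (hzg.2 a).2 _ ha hz
  have hsum : ∀ f g : (a : α) → Fin (c a + 1), f ≠ g → ∑ a, (f a : ℕ) = ∑ a, (g a : ℕ) →
      ∃ a, f a < g a := by
    intro f g hne hs
    by_contra! hle
    refine hne (funext fun a => Fin.ext ?_)
    exact ((Finset.sum_eq_sum_iff_of_le fun a _ => hle a).1 hs.symm a (Finset.mem_univ a)).symm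
  have hlevel : ∀ k : ℕ, ∃ O : {f : (a : α) → Fin (c a + 1) // ∑ a, (f a : ℕ) = k} → Set X,
      (∀ f, IsOpen (O f)) ∧ (∀ f, P f.1 ⊆ O f) ∧ Pairwise fun f g => Disjoint (O f) (O g) := by
    intro k
    refine exists_pairwise_disjoint_isOpen_superset _ fun f g hfg => ?_
    have hne : g.1 ≠ f.1 := fun h => hfg (Subtype.ext h.symm)
    exact (hPsep _ _ (hsum _ _ hne (g.2.trans f.2.symm))).symm
  choose O hO hPO hd using hlevel
  refine ⟨fun f => O _ ⟨f, rfl⟩ ∩ (Z ∩ ⋂ a, A a (f a)), fun f => ?_, fun f z hz => hz.2.1,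
    fun f a z hz => mem_iInter.1 hz.2.2 a, fun f g hne hs => ?_, fun z hz => ?_⟩
  · exact (hO _ _).inter (hZ.inter (isOpen_iInter_of_finite fun a => hA a _))
  · refine Disjoint.mono inter_subset_left inter_subset_left ?_
    have key : ∀ k, ∀ hf : ∑ a, (f a : ℕ) = k, ∀ hg : ∑ a, (g a : ℕ) = k,
        Disjoint (O _ ⟨f, rfl⟩) (O _ ⟨g, rfl⟩) := by
      rintro k rfl hg
      have hO' : O _ ⟨g, rfl⟩ = O (∑ a, (f a : ℕ)) ⟨g, hg⟩ := by
        generalize ∑ a, (f a : ℕ) = k at hg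
        subst hg
        rfl
      rw [hO']
      exact hd _ fun h => hne (congrArg Subtype.val h)
    exact key _ rfl hs.symm
  · have hex : ∀ a, ∃ j : Fin (c a + 1), z ∈ A a j ∧ ∀ j' < j, z ∉ A a j' := by
      intro a
      obtain ⟨j, hj⟩ := mem_iUnion.1 (hcov a hz)
      obtain ⟨m, hm, hmin⟩ := WellFounded.has_min (wellFounded_lt (α := Fin (c a + 1)))
        {j | z ∈ A a j} ⟨j, hj⟩
      exact ⟨m, hm, fun j' hj' hzj' => hmin j' hzj' hj'⟩
    choose f hf using hex
    exact mem_iUnion.2 ⟨f, hPO _ ⟨f, rfl⟩ ⟨hz, hf⟩, hz, mem_iInter.2 fun a => (hf a).1⟩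

/-- Motion planners on the members of a common refinement of several covers of `Z` by `c a + 1`
sets each combine to motion planners on only `∑ a, c a + 1` sets: those with the same sum of indices
are disjoint after shrinking. -/
theorem exists_cover_hasMotionPlanner [CompletelyNormalSpace (X × X)] {α : Type*} [Fintype α]
    (c : α → ℕ) {Z : Set (X × X)} (hZ : IsOpen Z) (A : (a : α) → Fin (c a + 1) → Set (X × X))
    (hA : ∀ a j, IsOpen (A a j)) (hcov : ∀ a, Z ⊆ ⋃ j, A a j)
    (hplan : ∀ f : (a : α) → Fin (c a + 1), HasMotionPlanner (Z ∩ ⋂ a, A a (f a))) :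
    ∃ U : Fin (∑ a, c a + 1) → Set (X × X), (∀ k, IsOpen (U k)) ∧ Z ⊆ ⋃ k, U k ∧
      ∀ k, HasMotionPlanner (U k) := by
  obtain ⟨O, hO, hOZ, hOA, hd, hOcov⟩ := exists_cover_of_covers c hZ A hA hcov
  refine ⟨fun k => ⋃ f : {f : (a : α) → Fin (c a + 1) // ∑ a, (f a : ℕ) = k}, O f.1,
    fun k => isOpen_iUnion fun f => hO _, fun z hz => ?_, fun k => ?_⟩
  · obtain ⟨f, hf⟩ := mem_iUnion.1 (hOcov hz)
    have hlt : ∑ a, (f a : ℕ) < ∑ a, c a + 1 :=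
      Nat.lt_succ_of_le (Finset.sum_le_sum fun a _ => Nat.le_of_lt_succ (f a).2)
    exact mem_iUnion.2 ⟨⟨_, hlt⟩, mem_iUnion.2 ⟨⟨f, rfl⟩, hf⟩⟩
  · refine HasMotionPlanner.iUnion (fun f => hO _) (fun f g hfg => ?_) fun f => ?_
    · exact hd _ _ (fun h => hfg (Subtype.ext h)) (f.2.trans g.2.symm)
    · exact (hplan f.1).mono
        (subset_inter (hOZ _) (subset_iInter fun a => hOA _ a))

/-- Over a product of two sets that contract in a path-connected space, a motion planner follows
one contraction to its centre, a fixed path between the centres, and the other contraction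
backwards. -/
theorem ContractibleIn.hasMotionPlanner_prod [PathConnectedSpace X] {U V : Set X}
    (hU : ContractibleIn U) (hV : ContractibleIn V) : HasMotionPlanner (U ×ˢ V) := by
  obtain ⟨u, ⟨F⟩⟩ := hU
  obtain ⟨v, ⟨H⟩⟩ := hV
  let p : (w : ↥(U ×ˢ V)) → Path w.1.1 u := fun w =>
    { toFun := fun τ => F (τ, ⟨w.1.1, w.2.1⟩)
      continuous_toFun := by fun_prop
      source' := by simp
      target' := by simp }
  let q : (w : ↥(U ×ˢ V)) → Path w.1.2 v := fun w =>
    { toFun := fun τ => H (τ, ⟨w.1.2, w.2.2⟩)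
      continuous_toFun := by fun_prop
      source' := by simp
      target' := by simp }
  have hp : Continuous ↿p :=
    show Continuous fun z : ↥(U ×ˢ V) × I => F (z.2, ⟨z.1.1.1, z.1.2.1⟩) by fun_prop
  have hq : Continuous ↿q :=
    show Continuous fun z : ↥(U ×ˢ V) × I => H (z.2, ⟨z.1.1.2, z.1.2.2⟩) by fun_prop
  let m : Path u v := PathConnectedSpace.somePath u v
  have hm : Continuous ↿fun _ : ↥(U ×ˢ V) => m :=
    show Continuous fun z : ↥(U ×ˢ V) × I => m z.2 by fun_prop
  have hc := Path.trans_continuous_family _ (Path.trans_continuous_family p hp _ hm) _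
    (Path.symm_continuous_family q hq)
  refine ⟨ContinuousMap.curry ⟨_, hc⟩, fun w => ⟨?_, ?_⟩⟩
  · exact (((p w).trans m).trans (q w).symm).source
  · exact (((p w).trans m).trans (q w).symm).target

theorem topComplexity_le_two_mul_lsCategory [PathConnectedSpace X]
    [CompletelyNormalSpace (X × X)] {N : ℕ} (hN : lsCategory X = N) :
    topComplexity X ≤ (2 * N : ℕ) := by
  obtain ⟨U, hU, hcov, hcontr⟩ := exists_cover_of_lsCategory_eq hN
  let π : Fin 2 → X × X → X := ![Prod.fst, Prod.snd]
  have hπ : ∀ a, Continuous (π a) := by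
    intro a
    fin_cases a
    exacts [continuous_fst, continuous_snd]
  obtain ⟨W, hW, hWcov, hWplan⟩ := exists_cover_hasMotionPlanner (fun _ : Fin 2 => N)
    isOpen_univ (fun a j => π a ⁻¹' U j) (fun a j => (hU j).preimage (hπ a))
    (fun a => by rw [← preimage_iUnion, hcov, preimage_univ])
    (fun f => ((hcontr (f 0)).hasMotionPlanner_prod (hcontr (f 1))).mono fun z hz =>
      ⟨mem_iInter.1 hz.2 0, mem_iInter.1 hz.2 1⟩)
  exact topComplexity_le_of_cover (by simp) W hW (univ_subset_iff.1 hWcov) hWplan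

end MotionPlanners

/-! ### Path lifting from local transports -/

section Transport

/-- A local transport for a group action on `S`: a `G`-equivariant way to move a point `x : S` to a
point `lift x b` of the orbit `b`, whenever the orbit of `x` is near `b` (the pair is in `dom`), and
continuous there. The values of `lift` at other pairs are junk. This is the only
local structure of the bundle `S → S / G` that path lifting needs. -/
structure LocalTransport (G S : Type*) [Group G] [TopologicalSpace S] [MulAction G S] where
  dom : Set (MulAction.orbitRel.Quotient G S × MulAction.orbitRel.Quotient G S)
  isOpen_dom : IsOpen dom
  diag_mem : ∀ b, (b, b) ∈ dom
  lift : S → MulAction.orbitRel.Quotient G S → S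
  continuousOn_lift : ContinuousOn (Function.uncurry lift) {p | (⟦p.1⟧, p.2) ∈ dom}
  mk_lift : ∀ x b, (⟦x⟧, b) ∈ dom → (⟦lift x b⟧ : MulAction.orbitRel.Quotient G S) = b
  lift_mk_self : ∀ x, lift x ⟦x⟧ = x
  lift_smul : ∀ (g : G) x b, (⟦x⟧, b) ∈ dom → lift (g • x) b = g • lift x b

variable {V Q : Type*} [TopologicalSpace V] [TopologicalSpace Q]

/-- A continuous family of paths, parametrized by a paracompact space, has a continuous choice of
mesh: times closer than `δ v` are sent by the path at `v` to `dom`-close points. -/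
theorem exists_continuous_mesh [ParacompactSpace V] [T2Space V] {dom : Set (Q × Q)}
    (hdom : IsOpen dom) (hdiag : ∀ b, (b, b) ∈ dom) {γ : V → I → Q}
    (hγ : Continuous (Function.uncurry γ)) :
    ∃ δ : C(V, ℝ), (∀ v, 0 < δ v) ∧ ∀ v (s s' : I), dist s s' ≤ δ v → (γ v s, γ v s') ∈ dom := by
  let T : V → Set ℝ := fun v => {d | 0 < d ∧ ∀ s s' : I, dist s s' ≤ d → (γ v s, γ v s') ∈ dom}
  have hconv : ∀ v, Convex ℝ (T v) := by
    intro v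
    refine Set.OrdConnected.convex ⟨fun a ha b hb c hc => ?_⟩
    exact ⟨ha.1.trans_le hc.1, fun s s' h => hb.2 s s' (h.trans hc.2)⟩
  have hloc : ∀ v, ∃ c : ℝ, ∀ᶠ w in 𝓝 v, c ∈ T w := by
    intro v
    have hO : IsOpen {p : V × (I × I) | (γ p.1 p.2.1, γ p.1 p.2.2) ∈ dom} := by
      refine hdom.preimage (f := fun p : V × (I × I) => (γ p.1 p.2.1, γ p.1 p.2.2)) ?_
      have h1 := hγ.comp (f := fun p : V × (I × I) => (p.1, p.2.1)) (by fun_prop)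
      have h2 := hγ.comp (f := fun p : V × (I × I) => (p.1, p.2.2)) (by fun_prop)
      exact h1.prodMk h2
    have hK : IsCompact (diagonal I) := isCompact_diagonal
    obtain ⟨A, B, hA, hB, hvA, hKB, hAB⟩ := generalized_tube_lemma (isCompact_singleton (x := v))
      hK hO (by
        rintro ⟨w, s, s'⟩ ⟨hw, hs⟩
        obtain rfl : s = s' := hs
        exact hdiag _)
    have hBu : B ∈ uniformity I := by
      rw [← nhdsSet_diagonal_eq_uniformity]
      exact hB.mem_nhdsSet.2 hKB
    obtain ⟨ε, hε, hεB⟩ := Metric.mem_uniformity_dist.1 hBu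
    refine ⟨ε / 2, Filter.eventually_of_mem (hA.mem_nhds (hvA rfl)) fun w hw => ?_⟩
    exact ⟨by positivity, fun s s' h => hAB (show (w, (s, s')) ∈ A ×ˢ B from
      ⟨hw, hεB (h.trans_lt (by linarith))⟩)⟩
  obtain ⟨δ, hδ⟩ := exists_continuous_forall_mem_convex_of_local_const hconv hloc
  exact ⟨δ, fun v => (hδ v).1, fun v => (hδ v).2⟩

variable {G S : Type*} [Group G] [TopologicalSpace S] [MulAction G S]

namespace LocalTransport

variable (L : LocalTransport G S)

/-- Transport of `x` along the path `γ` up to time `s`, by `k` steps of length `d`; it stops at the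
time `min (k * d) s`. -/
noncomputable def steps (γ : I → MulAction.orbitRel.Quotient G S) (d : ℝ) (x : S) (s : I) : ℕ → S
  | 0 => x
  | k + 1 => L.lift (steps γ d x s k) (γ (projIcc 0 1 zero_le_one (min ((k + 1) * d) s)))

variable {L} {γ : I → MulAction.orbitRel.Quotient G S} {d : ℝ} {x : S}

theorem dist_step_le (hd : 0 < d) (s : I) (k : ℕ) :
    dist (projIcc (0 : ℝ) 1 zero_le_one (min (k * d) s))
      (projIcc (0 : ℝ) 1 zero_le_one (min ((k + 1) * d) s)) ≤ d := by
  have hs := s.2.1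
  have hk : 0 ≤ k * d := by positivity
  have h1 : min (k * d) (s : ℝ) ∈ Icc (0 : ℝ) 1 :=
    ⟨le_min hk hs, (min_le_right _ _).trans s.2.2⟩
  have h2 : min ((k + 1) * d) (s : ℝ) ∈ Icc (0 : ℝ) 1 :=
    ⟨le_min (by positivity) hs, (min_le_right _ _).trans s.2.2⟩
  rw [projIcc_of_mem _ h1, projIcc_of_mem _ h2, Subtype.dist_eq, Real.dist_eq, abs_le]
  constructor <;> simp only <;> rcases min_cases (k * d) (s : ℝ) with h | h <;>
    rcases min_cases ((k + 1) * d) (s : ℝ) with h' | h' <;> nlinarith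

theorem mk_steps (hd : 0 < d) (hγ : ∀ s s' : I, dist s s' ≤ d → (γ s, γ s') ∈ L.dom)
    (hx : (⟦x⟧ : MulAction.orbitRel.Quotient G S) = γ 0) (s : I) (k : ℕ) :
    (⟦L.steps γ d x s k⟧ : MulAction.orbitRel.Quotient G S)
      = γ (projIcc 0 1 zero_le_one (min (k * d) s)) := by
  induction k with
  | zero =>
    have h0 : min ((0 : ℕ) * d) (s : ℝ) = 0 := by simpa using s.2.1
    rw [h0, projIcc_left]
    exact hx
  | succ k ih =>
    rw [steps, L.mk_lift]
    · push_cast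
      rfl
    · rw [ih]
      exact hγ _ _ (dist_step_le hd s k)

theorem steps_mem_dom (hd : 0 < d) (hγ : ∀ s s' : I, dist s s' ≤ d → (γ s, γ s') ∈ L.dom)
    (hx : (⟦x⟧ : MulAction.orbitRel.Quotient G S) = γ 0) (s : I) (k : ℕ) :
    ((⟦L.steps γ d x s k⟧ : MulAction.orbitRel.Quotient G S),
      γ (projIcc 0 1 zero_le_one (min ((k + 1) * d) s))) ∈ L.dom := by
  rw [mk_steps hd hγ hx]
  exact hγ _ _ (dist_step_le hd s k)

/-- Once the steps have reached the time `s`, further steps change nothing. -/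
theorem steps_eq_of_le (hd : 0 < d) (hγ : ∀ s s' : I, dist s s' ≤ d → (γ s, γ s') ∈ L.dom)
    (hx : (⟦x⟧ : MulAction.orbitRel.Quotient G S) = γ 0) (s : I) {k l : ℕ} (hk : (s : ℝ) ≤ k * d)
    (hkl : k ≤ l) : L.steps γ d x s l = L.steps γ d x s k := by
  induction l, hkl using Nat.le_induction with
  | base => rfl
  | succ l hkl ih =>
    have hl : (s : ℝ) ≤ l * d := hk.trans (by gcongr)
    have hl' : (s : ℝ) ≤ (l + 1) * d := hl.trans (by nlinarith)
    have hmk := mk_steps hd hγ hx s l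
    rw [min_eq_right hl] at hmk
    rw [steps, min_eq_right hl', ← hmk, L.lift_mk_self, ih]

theorem steps_smul (hd : 0 < d) (hγ : ∀ s s' : I, dist s s' ≤ d → (γ s, γ s') ∈ L.dom)
    (hx : (⟦x⟧ : MulAction.orbitRel.Quotient G S) = γ 0) (g : G) (s : I) (k : ℕ) :
    L.steps γ d (g • x) s k = g • L.steps γ d x s k := by
  induction k with
  | zero => rfl
  | succ k ih => rw [steps, ih, L.lift_smul _ _ _ (steps_mem_dom hd hγ hx s k), steps]

/-- Path lifting in `S → S / G`, simultaneously for a family of paths over a paracompact space,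
and `G`-equivariant in the initial point. -/
theorem exists_transport [ParacompactSpace V] [T2Space V] (L : LocalTransport G S)
    {γ : V → I → MulAction.orbitRel.Quotient G S} (hγ : Continuous (Function.uncurry γ)) :
    ∃ T : V → S → I → S,
      ContinuousOn (fun p : V × S × I => T p.1 p.2.1 p.2.2) {p | ⟦p.2.1⟧ = γ p.1 0} ∧
      (∀ v x, ⟦x⟧ = γ v 0 → T v x 0 = x) ∧
      (∀ v x s, ⟦x⟧ = γ v 0 → ⟦T v x s⟧ = γ v s) ∧
      ∀ v (g : G) x s, ⟦x⟧ = γ v 0 → T v (g • x) s = g • T v x s := by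
  obtain ⟨δ, hδ, hmesh⟩ := exists_continuous_mesh L.isOpen_dom L.diag_mem hγ
  have hreach : ∀ v (s : I) {k : ℕ}, 1 / δ v ≤ k → (s : ℝ) ≤ k * δ v := fun v s k hk =>
    s.2.2.trans ((div_le_iff₀ (hδ v)).1 hk)
  have hsteps : ∀ k : ℕ, ContinuousOn (fun p : V × S × I =>
      L.steps (γ p.1) (δ p.1) p.2.1 p.2.2 k) {p | ⟦p.2.1⟧ = γ p.1 0} := by
    intro k
    induction k with
    | zero => exact (continuous_fst.comp continuous_snd).continuousOn
    | succ k ih =>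
      have htime : Continuous fun p : V × S × I => γ p.1
          (projIcc 0 1 zero_le_one (min ((k + 1) * δ p.1) p.2.2)) :=
        hγ.comp (f := fun p : V × S × I => (p.1,
          projIcc (0 : ℝ) 1 zero_le_one (min ((k + 1) * δ p.1) p.2.2))) (by fun_prop)
      exact L.continuousOn_lift.comp (ih.prodMk htime.continuousOn) fun p hp =>
        steps_mem_dom (hδ p.1) (hmesh p.1) hp p.2.2 k
  refine ⟨fun v x s => L.steps (γ v) (δ v) x s ⌈1 / δ v⌉₊, fun p hp => ?_, fun v x hx => ?_,
    fun v x s hx => ?_, fun v g x s hx => steps_smul (hδ v) (hmesh v) hx g s _⟩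
  · -- Near `p` a fixed number of steps is enough.
    obtain ⟨K, hK⟩ := exists_nat_gt (1 / δ p.1)
    have hnear : ∀ᶠ q : V × S × I in 𝓝 p, 1 / δ q.1 < K := by
      have hc : ContinuousAt (fun q : V × S × I => 1 / δ q.1) p :=
        ContinuousAt.div (by fun_prop) (by fun_prop) (hδ _).ne'
      exact hc.eventually_lt continuousAt_const hK
    refine (hsteps K p hp).congr_of_eventuallyEq ?_ ?_
    · filter_upwards [mem_nhdsWithin_of_mem_nhds hnear, self_mem_nhdsWithin] with q hq hqx
      exact (steps_eq_of_le (hδ _) (hmesh _) hqx _ (hreach _ _ (Nat.le_ceil _))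
        (Nat.ceil_le.2 hq.le)).symm
    · exact (steps_eq_of_le (hδ _) (hmesh _) hp _ (hreach _ _ (Nat.le_ceil _))
        (Nat.ceil_le.2 hK.le)).symm
  · exact steps_eq_of_le (k := 0) (hδ v) (hmesh v) hx 0 (by simp) (Nat.zero_le _)
  · rw [mk_steps (hδ v) (hmesh v) hx, min_eq_right (hreach v s (Nat.le_ceil _)), projIcc_val]

open Classical in
/-- The form of `exists_transport` for a family of paths over a subset `U` of `V`; the transport has
junk values over points outside `U`. -/
theorem exists_transport_on {U : Set V} [ParacompactSpace U] [T2Space U] (L : LocalTransport G S)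
    {γ : V → I → MulAction.orbitRel.Quotient G S}
    (hγ : ContinuousOn (Function.uncurry γ) (U ×ˢ univ)) :
    ∃ T : V → S → I → S,
      ContinuousOn (fun p : V × S × I => T p.1 p.2.1 p.2.2) {p | p.1 ∈ U ∧ ⟦p.2.1⟧ = γ p.1 0} ∧
      (∀ v ∈ U, ∀ x, ⟦x⟧ = γ v 0 → T v x 0 = x) ∧
      (∀ v ∈ U, ∀ x s, ⟦x⟧ = γ v 0 → ⟦T v x s⟧ = γ v s) ∧
      ∀ v ∈ U, ∀ (g : G) x s, ⟦x⟧ = γ v 0 → T v (g • x) s = g • T v x s := by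
  have hγ' : Continuous (Function.uncurry fun (v : U) (s : I) => γ v s) :=
    hγ.comp_continuous (f := fun p : U × I => ((p.1 : V), p.2)) (by fun_prop)
      (fun p => ⟨p.1.2, mem_univ _⟩)
  obtain ⟨T, hT, hT0, hTγ, hTg⟩ := L.exists_transport hγ'
  refine ⟨fun v x s => if hv : v ∈ U then T ⟨v, hv⟩ x s else x, ?_, fun v hv x hx => ?_,
    fun v hv x s hx => ?_, fun v hv g x s hx => ?_⟩
  · rw [continuousOn_iff_continuous_domRestrict]
    have hc : Continuous fun p : ↥{p : V × S × I | p.1 ∈ U ∧ ⟦p.2.1⟧ = γ p.1 0} =>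
        T ⟨p.1.1, p.2.1⟩ p.1.2.1 p.1.2.2 :=
      hT.comp_continuous (f := fun p : ↥{p : V × S × I | p.1 ∈ U ∧ ⟦p.2.1⟧ = γ p.1 0} =>
        ((⟨p.1.1, p.2.1⟩ : U), p.1.2)) (by fun_prop) (fun p => p.2.2)
    refine hc.congr fun p => ?_
    simp [p.2.1]
  · simpa [hv] using hT0 ⟨v, hv⟩ x hx
  · simpa [hv] using hTγ ⟨v, hv⟩ x s hx
  · simpa [hv] using hTg ⟨v, hv⟩ g x s hx

end LocalTransport

end Transport

/-! ### Retraction of the circle to its torsion subgroups -/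

section Circle

/-- Nearest-point projection of the circle to its subgroup `ℤ_t`, on a neighbourhood `N` of this
subgroup. -/
theorem exists_retraction_torsionCircle (t : ℕ∞) (ht : 0 < t) :
    ∃ (N : Set Circle) (ρ : Circle → Circle), IsOpen N ∧ 1 ∈ N ∧
      (∀ h ∈ torsionCircle t, ∀ z ∈ N, h * z ∈ N) ∧ ContinuousOn ρ N ∧
      (∀ z, ρ z ∈ torsionCircle t) ∧ (∀ h ∈ torsionCircle t, ∀ z, ρ (h * z) = h * ρ z) ∧
      ρ 1 = 1 := by
  induction t using ENat.recTopCoe with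
  | top =>
    exact ⟨univ, id, isOpen_univ, mem_univ _, fun _ _ _ _ => mem_univ _, continuousOn_id,
      fun z => mem_torsionCircle_top z, fun _ _ _ => rfl, rfl⟩
  | coe k =>
    have hk : (k : ℝ) ≠ 0 := by
      have : 0 < k := by exact_mod_cast ht
      positivity
    have hpow : ∀ h ∈ torsionCircle (k : ℕ∞), ∀ z : Circle, (h * z) ^ k = z ^ k := by
      intro h hh z
      rw [mul_pow, (mem_torsionCircle_coe k h).1 hh, one_mul]
    -- The factor by which `z` is divided is the principal `k`-th root of `z ^ k`.
    refine ⟨{z | ((z ^ k : Circle) : ℂ) ∈ Complex.slitPlane},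
      fun z => z / Circle.exp (Complex.arg (z ^ k : Circle) / k), ?_, ?_, ?_, ?_, ?_, ?_, ?_⟩
    · exact Complex.isOpen_slitPlane.preimage (by fun_prop)
    · simp
    · intro h hh z hz
      rwa [mem_ofPred_eq, hpow h hh]
    · intro z hz
      have h1 : ContinuousAt (fun z : Circle => Complex.arg (z ^ k : Circle)) z :=
        (Complex.continuousAt_arg hz).comp
          (f := fun z : Circle => ((z ^ k : Circle) : ℂ)) (by fun_prop)
      have h2 : ContinuousAt
          (fun z : Circle => Circle.exp (Complex.arg (z ^ k : Circle) / k)) z :=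
        Circle.exp.continuous.continuousAt.comp (h1.div_const _)
      exact (continuousAt_id.div' h2).continuousWithinAt
    · intro z
      rw [mem_torsionCircle_coe, div_pow, ← Circle.exp_natCast_mul, mul_div_cancel₀ _ hk,
        Circle.exp_arg, div_self']
    · intro h hh z
      simp only [hpow h hh, mul_div_assoc]
    · simp

/-- The phase `c / |c|` of a complex number; the junk value at `0` is `1`. -/
noncomputable def circlePhase (c : ℂ) : Circle :=
  if h : c = 0 then 1 else ⟨c / ‖c‖, by
    simp [Submonoid.unitSphere, h]⟩

theorem coe_circlePhase {c : ℂ} (hc : c ≠ 0) : (circlePhase c : ℂ) = c / ‖c‖ := by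
  simp [circlePhase, hc]

theorem circlePhase_coe (z : Circle) : circlePhase z = z := by
  ext
  simp [coe_circlePhase, Circle.norm_coe]

theorem circlePhase_one : circlePhase 1 = 1 := circlePhase_coe 1

theorem circlePhase_mul (z : Circle) {c : ℂ} (hc : c ≠ 0) :
    circlePhase (z * c) = z * circlePhase c := by
  ext
  rw [Circle.coe_mul, coe_circlePhase hc, coe_circlePhase (mul_ne_zero z.coe_ne_zero hc), norm_mul,
    Circle.norm_coe, one_mul, mul_div_assoc]

theorem continuousOn_circlePhase : ContinuousOn circlePhase {c | c ≠ 0} := by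
  have hind : IsInducing (fun z : Circle => (z : ℂ)) := ⟨rfl⟩
  rw [hind.continuousOn_iff]
  have h : ContinuousOn (fun c : ℂ => c / (‖c‖ : ℂ)) {c | c ≠ 0} :=
    continuousOn_id.div (by fun_prop) fun c hc => by simpa using hc
  exact h.congr fun c hc => coe_circlePhase hc

end Circle

/-! ### Equivariant motion planners on odd spheres -/

section OddSpheres

-- Shortcut instances for the actions: without them, instance search first tries many algebraic
-- structures that spheres do not carry.

noncomputable instance OddSphere.instSMulCircle (m : ℕ) : SMul Circle (OddSphere m) :=
  (OddSphere.instMulActionCircle m).toSMul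

noncomputable instance OddSphereProduct.instMulActionCircle {r : ℕ} (n : Fin r → ℕ) :
    MulAction Circle (OddSphereProduct n) :=
  Pi.mulAction Circle

noncomputable instance OddSphereProduct.instSMulCircle {r : ℕ} (n : Fin r → ℕ) :
    SMul Circle (OddSphereProduct n) :=
  (OddSphereProduct.instMulActionCircle n).toSMul

noncomputable instance OddSphereProduct.instMulActionTorsionCircle {r : ℕ} (n : Fin r → ℕ)
    (t : ℕ∞) : MulAction (torsionCircle t) (OddSphereProduct n) :=
  Subgroup.instMulAction

noncomputable instance OddSphereProduct.instSMulTorsionCircle {r : ℕ} (n : Fin r → ℕ)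
    (t : ℕ∞) : SMul (torsionCircle t) (OddSphereProduct n) :=
  (OddSphereProduct.instMulActionTorsionCircle n t).toSMul

instance OddSphere.instContinuousSMulCircle (m : ℕ) : ContinuousSMul Circle (OddSphere m) where
  continuous_smul := by
    refine Continuous.subtype_mk (f := fun p : Circle × OddSphere m =>
      (p.1 : ℂ) • (p.2 : EuclideanSpace ℂ (Fin (m + 1)))) ?_ _
    fun_prop

instance OddSphere.instPathConnectedSpace (m : ℕ) : PathConnectedSpace (OddSphere m) := by
  refine isPathConnected_iff_pathConnectedSpace.1 (isPathConnected_sphere ?_ 0 zero_le_one)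
  rw [← rank_mul_rank ℝ ℂ, Complex.rank_real_complex, ← Module.finrank_eq_rank ℂ,
    finrank_euclideanSpace, Fintype.card_fin]
  exact_mod_cast (by omega : 1 < 2 * (m + 1))

instance OddSphereProduct.instContinuousSMulCircle {r : ℕ} (n : Fin r → ℕ) :
    ContinuousSMul Circle (OddSphereProduct n) :=
  ⟨continuous_pi fun i => continuous_fst.smul ((continuous_apply i).comp continuous_snd)⟩

instance OddSphereProduct.instContinuousSMulTorsionCircle {r : ℕ} (n : Fin r → ℕ) (t : ℕ∞) :
    ContinuousSMul (torsionCircle t) (OddSphereProduct n) :=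
  ⟨(continuous_subtype_val.comp continuous_fst).smul continuous_snd⟩

variable {m : ℕ}

theorem OddSphere.norm_coe (u : OddSphere m) : ‖(u : EuclideanSpace ℂ (Fin (m + 1)))‖ = 1 :=
  norm_eq_of_mem_sphere u

theorem OddSphere.smul_neg (z : Circle) (u : OddSphere m) : z • (-u) = -(z • u) :=
  Subtype.ext (_root_.smul_neg (z : ℂ) (u : EuclideanSpace ℂ (Fin (m + 1))))

theorem OddSphere.inner_self (u : OddSphere m) :
    inner ℂ (u : EuclideanSpace ℂ (Fin (m + 1))) u = 1 := by
  rw [inner_self_eq_norm_sq_to_K, u.norm_coe]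
  simp

theorem OddSphere.inner_smul_left (z : Circle) (u v : OddSphere m) :
    inner ℂ ((z • u : OddSphere m) : EuclideanSpace ℂ (Fin (m + 1))) v
      = ((z⁻¹ : Circle) : ℂ) * inner ℂ (u : EuclideanSpace ℂ (Fin (m + 1))) v := by
  rw [OddSphere.coe_smul, _root_.inner_smul_left, Circle.coe_inv_eq_conj]

theorem OddSphere.inner_smul_right (z : Circle) (u v : OddSphere m) :
    inner ℂ (u : EuclideanSpace ℂ (Fin (m + 1))) ((z • v : OddSphere m) :)
      = (z : ℂ) * inner ℂ (u : EuclideanSpace ℂ (Fin (m + 1))) v := by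
  rw [OddSphere.coe_smul, _root_.inner_smul_right]

/-- The chord from `u` to `v`, projected radially to the sphere. At a time when the chord meets the
centre the junk value is `u`. -/
noncomputable def OddSphere.segment (u v : OddSphere m) (s : I) : OddSphere m :=
  if h : ((1 - s : ℝ) : ℂ) • (u : EuclideanSpace ℂ (Fin (m + 1))) + ((s : ℝ) : ℂ) • v.1 = 0 then u
  else ⟨((‖((1 - s : ℝ) : ℂ) • u.1 + ((s : ℝ) : ℂ) • v.1‖⁻¹ : ℝ) : ℂ) •
      (((1 - s : ℝ) : ℂ) • u.1 + ((s : ℝ) : ℂ) • v.1), by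
    rw [mem_sphere_zero_iff_norm, norm_smul, Complex.norm_real, norm_inv, norm_norm,
      inv_mul_cancel₀ (norm_ne_zero_iff.2 h)]⟩

theorem OddSphere.chord_ne_zero {u v : OddSphere m} (huv : u ≠ -v) (s : I) :
    ((1 - s : ℝ) : ℂ) • u.1 + ((s : ℝ) : ℂ) • v.1 ≠ 0 := by
  intro h
  have h1 : ((1 - s : ℝ) : ℂ) • u.1 = -(((s : ℝ) : ℂ) • v.1) := eq_neg_of_add_eq_zero_left h
  have h2 : (1 - s : ℝ) = s := by
    have := congrArg norm h1
    rwa [norm_neg, norm_smul, norm_smul, u.norm_coe, v.norm_coe, mul_one, mul_one,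
      Complex.norm_real, Complex.norm_real, Real.norm_of_nonneg (sub_nonneg.2 s.2.2),
      Real.norm_of_nonneg s.2.1] at this
  have hs : ((s : ℝ) : ℂ) ≠ 0 := by
    rw [Complex.ofReal_ne_zero]
    intro h0
    rw [h0] at h2
    norm_num at h2
  rw [h2, ← _root_.smul_neg] at h1
  exact huv (Subtype.ext (smul_right_injective _ hs h1))

theorem OddSphere.segment_zero (u v : OddSphere m) : OddSphere.segment u v 0 = u := by
  ext1
  have h : ((1 - (0 : I) : ℝ) : ℂ) • u.1 + (((0 : I) : ℝ) : ℂ) • v.1 = u.1 := by simp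
  rw [segment]
  split_ifs with h0
  · rfl
  · simp only [h, u.norm_coe]
    simp

theorem OddSphere.segment_one (u v : OddSphere m) : OddSphere.segment u v 1 = v := by
  ext1
  have h : ((1 - (1 : I) : ℝ) : ℂ) • u.1 + (((1 : I) : ℝ) : ℂ) • v.1 = v.1 := by simp
  rw [segment]
  split_ifs with h0
  · rw [h] at h0
    exact absurd h0 (norm_ne_zero_iff.1 (by rw [v.norm_coe]; exact one_ne_zero))
  · simp only [h, v.norm_coe]
    simp

theorem OddSphere.segment_smul (z : Circle) (u v : OddSphere m) (s : I) :
    OddSphere.segment (z • u) (z • v) s = z • OddSphere.segment u v s := by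
  have h : ((1 - s : ℝ) : ℂ) • (z • u).1 + ((s : ℝ) : ℂ) • (z • v).1
      = (z : ℂ) • (((1 - s : ℝ) : ℂ) • u.1 + ((s : ℝ) : ℂ) • v.1) := by
    rw [coe_smul, coe_smul, smul_add, smul_comm (z : ℂ), smul_comm (z : ℂ)]
  ext1
  by_cases h0 : ((1 - s : ℝ) : ℂ) • u.1 + ((s : ℝ) : ℂ) • v.1 = 0
  · rw [segment, segment, dif_pos h0, dif_pos (by rw [h, h0, smul_zero])]
  · rw [coe_smul, segment, segment, dif_neg h0,
      dif_neg (by rw [h]; exact smul_ne_zero z.coe_ne_zero h0)]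
    simp only [h, norm_smul, Circle.norm_coe, one_mul]
    rw [smul_comm]

theorem OddSphere.continuousOn_segment :
    ContinuousOn (fun p : OddSphere m × OddSphere m × I => OddSphere.segment p.1 p.2.1 p.2.2)
      {p | p.1 ≠ -p.2.1} := by
  rw [Topology.IsInducing.continuousOn_iff Topology.IsInducing.subtypeVal]
  have hw : Continuous fun p : OddSphere m × OddSphere m × I =>
      ((1 - p.2.2 : ℝ) : ℂ) • p.1.1 + ((p.2.2 : ℝ) : ℂ) • p.2.1.1 := by
    fun_prop
  have hinv : ContinuousOn (fun p : OddSphere m × OddSphere m × I =>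
      ((‖((1 - p.2.2 : ℝ) : ℂ) • p.1.1 + ((p.2.2 : ℝ) : ℂ) • p.2.1.1‖⁻¹ : ℝ) : ℂ))
      {p | p.1 ≠ -p.2.1} :=
    Complex.continuous_ofReal.comp_continuousOn
      (hw.norm.continuousOn.inv₀ fun p hp => norm_ne_zero_iff.2 (chord_ne_zero hp p.2.2))
  have h := hinv.smul hw.continuousOn
  refine h.congr fun p hp => ?_
  rw [Function.comp_apply, segment, dif_neg (chord_ne_zero hp p.2.2)]
  rfl

/-- The two sets of pairs of points of the sphere on which the motion planner `OddSphere.plan` is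
continuous: not antipodal, and not equal. -/
def OddSphere.planDomain (ε : Fin 2) : Set (OddSphere m × OddSphere m) :=
  if ε = 0 then {p | p.1 ≠ -p.2} else {p | p.1 ≠ p.2}

/-- Motion planners on an odd sphere. The first follows the shortest geodesic from `u` to `v`. The
second rotates the geodesic from `u` to `-v` by the complex numbers `e^{iπs}`. Both commute with the
action of `S^1`. -/
noncomputable def OddSphere.plan (ε : Fin 2) (u v : OddSphere m) (s : I) : OddSphere m :=
  if ε = 0 then OddSphere.segment u v s
  else Circle.exp (Real.pi * s) • OddSphere.segment u (-v) s

theorem OddSphere.isOpen_planDomain (ε : Fin 2) :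
    IsOpen (OddSphere.planDomain ε : Set (OddSphere m × OddSphere m)) := by
  unfold planDomain
  split_ifs
  · exact isOpen_ne_fun continuous_fst continuous_snd.neg
  · exact isOpen_ne_fun continuous_fst continuous_snd

theorem OddSphere.exists_mem_planDomain (p : OddSphere m × OddSphere m) :
    ∃ ε, p ∈ OddSphere.planDomain ε := by
  by_cases h : p.1 = p.2
  · refine ⟨0, ?_⟩
    simp only [planDomain, if_true, mem_ofPred_eq, h]
    exact fun h' => ne_neg_of_mem_unit_sphere ℝ p.2 h'
  · exact ⟨1, by simpa [planDomain] using h⟩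

theorem OddSphere.smul_mem_planDomain_iff (ε : Fin 2) (z : Circle) (u v : OddSphere m) :
    (z • u, z • v) ∈ (OddSphere.planDomain ε : Set (OddSphere m × OddSphere m)) ↔
      (u, v) ∈ (OddSphere.planDomain ε : Set (OddSphere m × OddSphere m)) := by
  unfold planDomain
  split_ifs
  · simp only [mem_ofPred_eq, ← smul_neg, ne_eq, smul_left_cancel_iff]
  · simp only [mem_ofPred_eq, ne_eq, smul_left_cancel_iff]

theorem OddSphere.plan_zero (ε : Fin 2) (u v : OddSphere m) : OddSphere.plan ε u v 0 = u := by
  unfold plan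
  split_ifs
  · exact segment_zero u v
  · simp [segment_zero]

theorem OddSphere.plan_one (ε : Fin 2) (u v : OddSphere m) : OddSphere.plan ε u v 1 = v := by
  unfold plan
  split_ifs
  · exact segment_one u v
  · ext1
    rw [segment_one, coe_smul]
    simp [Circle.coe_exp]

theorem OddSphere.plan_smul (ε : Fin 2) (z : Circle) (u v : OddSphere m) (s : I) :
    OddSphere.plan ε (z • u) (z • v) s = z • OddSphere.plan ε u v s := by
  unfold plan
  split_ifs
  · exact segment_smul z u v s
  · rw [← smul_neg, segment_smul, smul_comm]

theorem OddSphere.continuousOn_plan (ε : Fin 2) :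
    ContinuousOn (fun p : OddSphere m × OddSphere m × I => OddSphere.plan ε p.1 p.2.1 p.2.2)
      {p | (p.1, p.2.1) ∈ OddSphere.planDomain ε} := by
  unfold plan planDomain
  split_ifs
  · exact continuousOn_segment
  · have hexp : Continuous fun p : OddSphere m × OddSphere m × I =>
        Circle.exp (Real.pi * p.2.2) := by fun_prop
    have hneg : Continuous fun p : OddSphere m × OddSphere m × I => (p.1, -p.2.1, p.2.2) := by
      fun_prop
    refine hexp.continuousOn.smul (continuousOn_segment.comp hneg.continuousOn fun p hp => ?_)
    simpa using hp

end OddSpheres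

/-! ### Topology of the orbit spaces -/

section Quotients

theorem isClosed_torsionCircle (t : ℕ∞) : IsClosed (torsionCircle t : Set Circle) := by
  induction t using ENat.recTopCoe with
  | top => exact isClosed_univ
  | coe k => exact isClosed_singleton.preimage (continuous_pow k)

variable {r : ℕ} {n : Fin r → ℕ} {t : ℕ∞}

theorem CPProduct.isOpenQuotientMap_mk :
    IsOpenQuotientMap (Quotient.mk _ : OddSphereProduct n → CPProduct n t) :=
  MulAction.isOpenQuotientMap_quotientMk

theorem CPProduct.mk_smul (g : torsionCircle t) (x : OddSphereProduct n) :
    (⟦g • x⟧ : CPProduct n t) = ⟦x⟧ :=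
  Quotient.sound ⟨g, rfl⟩

theorem CPProduct.mk_circle_smul {z : Circle} (hz : z ∈ torsionCircle t)
    (x : OddSphereProduct n) : (⟦z • x⟧ : CPProduct n t) = ⟦x⟧ :=
  CPProduct.mk_smul ⟨z, hz⟩ x

theorem CPProduct.exists_smul_eq {x y : OddSphereProduct n}
    (h : (⟦x⟧ : CPProduct n t) = ⟦y⟧) : ∃ g : torsionCircle t, g • y = x :=
  Quotient.exact h

instance CPProduct.instT2Space : T2Space (CPProduct n t) := by
  have : CompactSpace (torsionCircle t) :=
    isCompact_iff_compactSpace.1 (isClosed_torsionCircle t).isCompact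
  have : ProperSMul (torsionCircle t) (OddSphereProduct n) := by
    have hc : Continuous fun p : torsionCircle t × OddSphereProduct n => (p.1 • p.2, p.2) := by
      fun_prop
    exact ⟨hc.isProperMap⟩
  exact t2Space_quotient_mulAction_of_properSMul

instance CPProduct.instSecondCountableTopology : SecondCountableTopology (CPProduct n t) :=
  ContinuousConstSMul.secondCountableTopology

instance CPProduct.instPathConnectedSpace : PathConnectedSpace (CPProduct n t) :=
  Quotient.mk_surjective.pathConnectedSpace CPProduct.isOpenQuotientMap_mk.continuous

instance CPProduct.instCompactSpace : CompactSpace (CPProduct n t) :=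
  Quotient.compactSpace

end Quotients

/-! ### Local transports and local contractibility of the orbit spaces -/

section LocalStructure

variable {r : ℕ} {n : Fin r → ℕ} {t : ℕ∞}

/-- On `S^{2n_1+1} × ⋯ × S^{2n_r+1}` a point `x` is moved to the multiple `z • y`, `z ∈ ℤ_t`, whose
phase relative to `x` in one of the factors is smallest. -/
theorem CPProduct.nonempty_localTransport (ht : 0 < t) (i : Fin r) :
    Nonempty (LocalTransport (torsionCircle t) (OddSphereProduct n)) := by
  obtain ⟨N, ρ, hN, h1N, hNmul, hρc, hρmem, hρmul, hρ1⟩ := exists_retraction_torsionCircle t ht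
  let c : OddSphereProduct n → OddSphereProduct n → ℂ := fun x y => inner ℂ (y i).1 (x i).1
  have hc : Continuous fun p : OddSphereProduct n × OddSphereProduct n => c p.1 p.2 := by
    fun_prop
  have hcsmul : ∀ (g h : Circle) x y, c (g • x) (h • y) = ((h⁻¹ * g : Circle) : ℂ) * c x y := by
    intro g h x y
    change inner ℂ (h • y i : OddSphere (n i)).1 (g • x i : OddSphere (n i)).1 = _
    rw [OddSphere.inner_smul_left, OddSphere.inner_smul_right, Circle.coe_mul, mul_assoc]
  let D : Set (OddSphereProduct n × OddSphereProduct n) :=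
    {p | c p.1 p.2 ≠ 0 ∧ circlePhase (c p.1 p.2) ∈ N}
  have hphase : ContinuousOn (fun p : OddSphereProduct n × OddSphereProduct n =>
      circlePhase (c p.1 p.2)) {p | c p.1 p.2 ≠ 0} :=
    continuousOn_circlePhase.comp hc.continuousOn fun p hp => hp
  have hD : IsOpen D := hphase.isOpen_inter_preimage (isOpen_ne_fun hc continuous_const) hN
  have hDsmul : ∀ (g h : torsionCircle t) x y, (x, y) ∈ D → (g • x, h • y) ∈ D := by
    rintro g h x y ⟨h0, hxy⟩
    have heq : c (g • x) (h • y) = ((h⁻¹ * g : Circle) : ℂ) * c x y := hcsmul g h x y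
    refine ⟨?_, ?_⟩
    · change c (g • x) (h • y) ≠ 0
      rw [heq]
      exact mul_ne_zero (Circle.coe_ne_zero _) h0
    · change circlePhase (c (g • x) (h • y)) ∈ N
      rw [heq, circlePhase_mul _ h0]
      exact hNmul _ (mul_mem (inv_mem h.2) g.2) _ hxy
  have hDq : ∀ x y x' y', (⟦x⟧ : CPProduct n t) = ⟦x'⟧ → (⟦y⟧ : CPProduct n t) = ⟦y'⟧ →
      (x', y') ∈ D → (x, y) ∈ D := by
    intro x y x' y' hx hy hxy
    obtain ⟨g, rfl⟩ := CPProduct.exists_smul_eq hx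
    obtain ⟨h, rfl⟩ := CPProduct.exists_smul_eq hy
    exact hDsmul g h _ _ hxy
  let q : OddSphereProduct n × OddSphereProduct n → CPProduct n t × CPProduct n t :=
    Prod.map (Quotient.mk _) (Quotient.mk _)
  have hq : IsOpenQuotientMap q :=
    CPProduct.isOpenQuotientMap_mk.prodMap CPProduct.isOpenQuotientMap_mk
  have hdom : ∀ x y, ((⟦x⟧ : CPProduct n t), (⟦y⟧ : CPProduct n t)) ∈ q '' D → (x, y) ∈ D := by
    rintro x y ⟨p, hp, hpq⟩
    exact hDq _ _ _ _ (congrArg Prod.fst hpq).symm (congrArg Prod.snd hpq).symm hp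
  let lift : OddSphereProduct n → CPProduct n t → OddSphereProduct n := fun x b =>
    ρ (circlePhase (c x b.out)) • b.out
  have hlift : ∀ x y, (x, y) ∈ D → lift x ⟦y⟧ = ρ (circlePhase (c x y)) • y := by
    intro x y hxy
    obtain ⟨g, hg⟩ := CPProduct.exists_smul_eq (Quotient.out_eq (⟦y⟧ : CPProduct n t))
    have hg' : (⟦y⟧ : CPProduct n t).out = (g : Circle) • y := hg.symm
    have hc' : c x ((g : Circle) • y) = (((g : Circle)⁻¹ : Circle) : ℂ) * c x y := by
      simpa using hcsmul 1 g x y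
    change ρ (circlePhase (c x (⟦y⟧ : CPProduct n t).out)) • (⟦y⟧ : CPProduct n t).out = _
    rw [hg', hc', circlePhase_mul _ hxy.1, hρmul _ (inv_mem g.2), smul_smul, mul_right_comm,
      inv_mul_cancel, one_mul]
  refine ⟨{
    dom := q '' D
    isOpen_dom := hq.isOpenMap _ hD
    diag_mem := ?_
    lift := lift
    continuousOn_lift := ?_
    mk_lift := ?_
    lift_mk_self := ?_
    lift_smul := ?_ }⟩
  · intro b
    induction b using Quotient.inductionOn with | h x =>
    have hxx : c x x = 1 := OddSphere.inner_self (x i)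
    exact ⟨(x, x), ⟨by simp [hxx], by simpa [hxx, circlePhase_one] using h1N⟩, rfl⟩
  · refine (IsOpenQuotientMap.id.prodMap CPProduct.isOpenQuotientMap_mk).continuousOn_of_comp ?_
    have h : ContinuousOn (fun p : OddSphereProduct n × OddSphereProduct n =>
        ρ (circlePhase (c p.1 p.2)) • p.2) D :=
      (hρc.comp (hphase.mono fun p hp => hp.1) fun p hp => hp.2).smul continuousOn_snd
    exact (h.mono fun p hp => hdom _ _ hp).congr fun p hp => hlift _ _ (hdom _ _ hp)
  · intro x b hxb
    induction b using Quotient.inductionOn with | h y =>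
    rw [hlift _ _ (hdom _ _ hxb)]
    exact CPProduct.mk_circle_smul (hρmem _) y
  · intro x
    have hxx : c x x = 1 := OddSphere.inner_self (x i)
    rw [hlift x x ⟨by simp [hxx], by simpa [hxx, circlePhase_one] using h1N⟩, hxx, circlePhase_one,
      hρ1, one_smul]
  · intro g x b hxb
    induction b using Quotient.inductionOn with | h y =>
    have hxy := hdom _ _ hxb
    have hgxy : (g • x, y) ∈ D := by simpa using hDsmul g 1 x y hxy
    have hc' : c ((g : Circle) • x) y = ((g : Circle) : ℂ) * c x y := by
      simpa using hcsmul g 1 x y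
    change c (g • x) y = ((g : Circle) : ℂ) * c x y at hc'
    rw [hlift _ _ hxy, hlift _ _ hgxy, hc', circlePhase_mul _ hxy.1, hρmul _ g.2, mul_smul]
    rfl

/-- Transport to the point `x`, and then along geodesics to `x`, contracts a neighbourhood of its
class. -/
theorem CPProduct.exists_contractibleIn_nhd (ht : 0 < t) (i : Fin r) (b : CPProduct n t) :
    ∃ U : Set (CPProduct n t), IsOpen U ∧ b ∈ U ∧ ContractibleIn U := by
  obtain ⟨L⟩ := CPProduct.nonempty_localTransport (n := n) ht i
  induction b using Quotient.inductionOn with | h x =>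
  let W : Set (CPProduct n t) := {b | (⟦x⟧, b) ∈ L.dom}
  have hW : IsOpen W := L.isOpen_dom.preimage (by fun_prop)
  have hlift : ContinuousOn (fun b => L.lift x b) W :=
    L.continuousOn_lift.comp (f := fun b => (x, b)) (by fun_prop) fun b hb => hb
  let O : Set (OddSphereProduct n) := {y | ∀ j, y j ≠ -x j}
  have hO : IsOpen O := by
    simp only [O, ofPred_forall]
    exact isOpen_iInter_of_finite fun j => isOpen_ne_fun (continuous_apply j) continuous_const
  let U := W ∩ (fun b => L.lift x b) ⁻¹' O
  have hU : IsOpen U := hlift.isOpen_inter_preimage hW hO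
  have hxU : (⟦x⟧ : CPProduct n t) ∈ U := by
    refine ⟨L.diag_mem _, ?_⟩
    change L.lift x ⟦x⟧ ∈ O
    rw [L.lift_mk_self]
    exact fun j => ne_neg_of_mem_unit_sphere ℝ (x j)
  refine ⟨U, hU, hxU, ⟦x⟧, ⟨{
    toFun := fun p => ⟦fun j => OddSphere.segment (L.lift x p.2 j) (x j) p.1⟧
    continuous_toFun := ?_
    map_zero_left := ?_
    map_one_left := ?_ }⟩⟩
  · refine CPProduct.isOpenQuotientMap_mk.continuous.comp (continuous_pi fun j => ?_)
    have hl : Continuous fun p : I × U => L.lift x p.2 j :=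
      (continuous_apply j).comp (hlift.comp_continuous (by fun_prop) fun p => p.2.2.1)
    exact OddSphere.continuousOn_segment.comp_continuous
      (f := fun p : I × U => (L.lift x p.2 j, x j, p.1)) (by fun_prop) fun p => p.2.2.2 j
  · intro b
    simp only [OddSphere.segment_zero]
    exact L.mk_lift x b b.2.1
  · intro b
    simp only [OddSphere.segment_one]
    rfl

theorem CPProduct.lsCategory_ne_top (ht : 0 < t) (i : Fin r) : lsCategory (CPProduct n t) ≠ ⊤ := by
  choose U hU hbU hcontr using CPProduct.exists_contractibleIn_nhd (n := n) ht i
  obtain ⟨F, -, hF⟩ := isCompact_univ.elim_nhds_subcover U fun b _ => (hU b).mem_nhds (hbU b)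
  obtain ⟨b, hb⟩ : (univ : Set (CPProduct n t)).Nonempty := univ_nonempty
  have hpos : 0 < F.card := by
    obtain ⟨b', hb', -⟩ := mem_iUnion₂.1 (hF hb)
    exact Finset.card_pos.2 ⟨b', hb'⟩
  have hle := lsCategory_le_of_cover (ι := F) (N := F.card - 1)
    (by rw [Fintype.card_coe]; omega) (fun b => U b.1) (fun b => hU _)
    (by rw [← univ_subset_iff, iUnion_subtype]; exact hF) (fun b => hcontr _)
  exact ne_top_of_le_ne_top (ENat.natCast_ne_top _) hle

end LocalStructure

/-! ### Lifting motion planners to the total space -/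

section Fibration

variable {r : ℕ} {n : Fin r → ℕ} {t : ℕ∞}

/-- The bundle projection of `CP_n(t)` onto the projective space of its `i`-th factor. -/
noncomputable def CPProduct.proj (i : Fin r) : CPProduct n t → CPProduct (fun _ : Fin 1 => n i) t :=
  Quotient.map (fun x _ => x i) (by
    rintro x y ⟨g, rfl⟩
    exact ⟨g, rfl⟩)

theorem CPProduct.continuous_proj (i : Fin r) :
    Continuous (CPProduct.proj i : CPProduct n t → _) :=
  Continuous.quotient_map' (continuous_pi fun _ => continuous_apply i) _

/-- A motion planner on a set `V` of pairs of points of the base is lifted to the `i`-th sphere: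
`w x y` is a path in this sphere that starts at `x i`, lies over the planned path from the class of
`x i` to the class of `y i`, and so ends at a multiple `θ x y • y i`. -/
theorem CPProduct.exists_lifted_planner (ht : 0 < t) (i : Fin r)
    {V : Set (CPProduct (fun _ : Fin 1 => n i) t × CPProduct (fun _ : Fin 1 => n i) t)}
    (hV : HasMotionPlanner V) {Z : Set (OddSphereProduct n × OddSphereProduct n)}
    (hZ : ∀ x y, (x, y) ∈ Z ↔
      (CPProduct.proj i (⟦x⟧ : CPProduct n t), CPProduct.proj i (⟦y⟧ : CPProduct n t)) ∈ V) :
    ∃ (w : OddSphereProduct n → OddSphereProduct n → I → OddSphere (n i))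
      (θ : OddSphereProduct n → OddSphereProduct n → Circle),
      ContinuousOn (fun p : (OddSphereProduct n × OddSphereProduct n) × I => w p.1.1 p.1.2 p.2)
        (Z ×ˢ univ) ∧
      ContinuousOn (fun p : OddSphereProduct n × OddSphereProduct n => θ p.1 p.2) Z ∧
      (∀ x y, (x, y) ∈ Z → θ x y ∈ torsionCircle t) ∧
      (∀ x y, (x, y) ∈ Z → w x y 0 = x i) ∧
      (∀ x y, (x, y) ∈ Z → w x y 1 = θ x y • y i) ∧
      (∀ x y, (x, y) ∈ Z → ∀ (g h : torsionCircle t) s,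
        w (g • x) (h • y) s = (g : Circle) • w x y s) ∧
      ∀ x y, (x, y) ∈ Z → ∀ g h : torsionCircle t,
        θ (g • x) (h • y) = (g : Circle) * θ x y * (h : Circle)⁻¹ := by
  obtain ⟨f, hf, hf0, hf1⟩ := hV.exists_continuousOn
  obtain ⟨L⟩ := CPProduct.nonempty_localTransport (n := fun _ : Fin 1 => n i) ht 0
  let := TopologicalSpace.metrizableSpaceMetric V
  obtain ⟨T, hT, hT0, hTf, hTg⟩ := L.exists_transport_on hf
  let pr : OddSphereProduct n → OddSphereProduct (fun _ : Fin 1 => n i) := fun x _ => x i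
  have hpr : Continuous pr := continuous_pi fun _ => continuous_apply i
  let v : OddSphereProduct n → OddSphereProduct n →
    CPProduct (fun _ : Fin 1 => n i) t × CPProduct (fun _ : Fin 1 => n i) t :=
    fun x y => (⟦pr x⟧, ⟦pr y⟧)
  have hv : Continuous fun p : OddSphereProduct n × OddSphereProduct n => v p.1 p.2 :=
    (CPProduct.isOpenQuotientMap_mk.continuous.comp (hpr.comp continuous_fst)).prodMk
      (CPProduct.isOpenQuotientMap_mk.continuous.comp (hpr.comp continuous_snd))
  have hvV : ∀ x y, (x, y) ∈ Z → v x y ∈ V := fun x y hxy => (hZ x y).1 hxy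
  have hstart : ∀ x y, (x, y) ∈ Z → ⟦pr x⟧ = f (v x y) 0 := fun x y hxy =>
    (hf0 _ (hvV x y hxy)).symm
  have hvsmul : ∀ (g h : torsionCircle t) x y, v (g • x) (h • y) = v x y := by
    intro g h x y
    exact Prod.ext (CPProduct.mk_smul g (pr x)) (CPProduct.mk_smul h (pr y))
  let w : OddSphereProduct n → OddSphereProduct n → I → OddSphere (n i) :=
    fun x y s => T (v x y) (pr x) s 0
  have hw : ContinuousOn
      (fun p : (OddSphereProduct n × OddSphereProduct n) × I => w p.1.1 p.1.2 p.2)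
      (Z ×ˢ univ) := by
    refine (continuous_apply (0 : Fin 1)).comp_continuousOn
      (hT.comp (f := fun p : (OddSphereProduct n × OddSphereProduct n) × I =>
        (v p.1.1 p.1.2, pr p.1.1, p.2)) ?_ fun p hp => ⟨hvV _ _ hp.1, hstart _ _ hp.1⟩)
    exact ((hv.comp continuous_fst).prodMk
      ((hpr.comp (continuous_fst.comp continuous_fst)).prodMk continuous_snd)).continuousOn
  have hwsmul : ∀ x y, (x, y) ∈ Z → ∀ (g h : torsionCircle t) s,
      w (g • x) (h • y) s = (g : Circle) • w x y s := by
    intro x y hxy g h s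
    change T (v (g • x) (h • y)) (g • pr x) s 0 = _
    rw [hvsmul, hTg _ (hvV x y hxy) _ _ _ (hstart x y hxy)]
    rfl
  let θ : OddSphereProduct n → OddSphereProduct n → Circle :=
    fun x y => circlePhase (inner ℂ (y i).1 (w x y 1).1)
  have hθ : ∀ x y, (x, y) ∈ Z → θ x y ∈ torsionCircle t ∧ w x y 1 = θ x y • y i ∧
      inner ℂ (y i).1 (w x y 1).1 = (θ x y : ℂ) := by
    intro x y hxy
    have hend : (⟦T (v x y) (pr x) 1⟧ : CPProduct (fun _ : Fin 1 => n i) t) = ⟦pr y⟧ := by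
      rw [hTf _ (hvV x y hxy) _ _ (hstart x y hxy), hf1 _ (hvV x y hxy)]
    obtain ⟨g, hg⟩ := CPProduct.exists_smul_eq hend
    have hg' : w x y 1 = (g : Circle) • y i := (congrFun hg 0).symm
    have hinner : inner ℂ (y i).1 (w x y 1).1 = ((g : Circle) : ℂ) := by
      rw [hg', OddSphere.inner_smul_right, OddSphere.inner_self, mul_one]
    have hθg : θ x y = g := by
      change circlePhase _ = _
      rw [hinner, circlePhase_coe]
    rw [hθg]
    exact ⟨g.2, hg', hinner⟩
  refine ⟨w, θ, hw, ?_, fun x y h => (hθ x y h).1, fun x y hxy => ?_, fun x y h => (hθ x y h).2.1,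
    hwsmul, fun x y hxy g h => ?_⟩
  · refine continuousOn_circlePhase.comp ?_ fun p hp => ?_
    · have hw1 : ContinuousOn (fun p : OddSphereProduct n × OddSphereProduct n => w p.1 p.2 1) Z :=
        hw.comp (f := fun p : OddSphereProduct n × OddSphereProduct n => (p, (1 : I)))
          (by fun_prop) fun p hp => ⟨hp, mem_univ _⟩
      have hy : ContinuousOn (fun p : OddSphereProduct n × OddSphereProduct n => (p.2 i).1) Z := by
        fun_prop
      exact ContinuousOn.inner (𝕜 := ℂ) hy (continuous_subtype_val.comp_continuousOn hw1)
    · change inner ℂ (p.2 i).1 (w p.1 p.2 1).1 ≠ 0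
      rw [(hθ p.1 p.2 hp).2.2]
      exact Circle.coe_ne_zero _
  · exact congrFun (hT0 _ (hvV x y hxy) _ (hstart x y hxy)) 0
  · change circlePhase (inner ℂ ((h : Circle) • y i : OddSphere (n i)).1
      (w (g • x) (h • y) 1).1) = _
    rw [hwsmul x y hxy, OddSphere.inner_smul_left, OddSphere.inner_smul_right, (hθ x y hxy).2.2]
    rw [← Circle.coe_mul, ← Circle.coe_mul, circlePhase_coe, mul_comm]

/-- Over a pair of open sets of the base with a motion planner, the total space needs `r` motion
planners: the point `x` is transported along the lifted path in the `i`-th sphere, and the other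
`r - 1` coordinates are moved by one of the two equivariant planners on their spheres. -/
theorem CPProduct.exists_cover_preimage (ht : 0 < t) (i : Fin r)
    {V : Set (CPProduct (fun _ : Fin 1 => n i) t × CPProduct (fun _ : Fin 1 => n i) t)}
    (hVo : IsOpen V) (hV : HasMotionPlanner V) :
    ∃ U : Fin r → Set (CPProduct n t × CPProduct n t), (∀ k, IsOpen (U k)) ∧
      Prod.map (CPProduct.proj i) (CPProduct.proj i) ⁻¹' V ⊆ (⋃ k, U k) ∧
      ∀ k, HasMotionPlanner (U k) := by
  classical
  let q : OddSphereProduct n × OddSphereProduct n → CPProduct n t × CPProduct n t :=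
    Prod.map (Quotient.mk _) (Quotient.mk _)
  have hq : IsOpenQuotientMap q :=
    CPProduct.isOpenQuotientMap_mk.prodMap CPProduct.isOpenQuotientMap_mk
  let ZE : Set (CPProduct n t × CPProduct n t) :=
    Prod.map (CPProduct.proj i) (CPProduct.proj i) ⁻¹' V
  have hZE : IsOpen ZE :=
    hVo.preimage ((CPProduct.continuous_proj i).prodMap (CPProduct.continuous_proj i))
  let Z : Set (OddSphereProduct n × OddSphereProduct n) := q ⁻¹' ZE
  have hZ : IsOpen Z := hZE.preimage hq.continuous
  obtain ⟨w, θ, hw, hθ, hθmem, hw0, hw1, hwsmul, hθsmul⟩ :=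
    CPProduct.exists_lifted_planner ht i hV (Z := Z) fun x y => Iff.rfl
  let A' : {j : Fin r // j ≠ i} → Fin 2 → Set (OddSphereProduct n × OddSphereProduct n) :=
    fun j ε => Z ∩ (fun p => (p.1 j, θ p.1 p.2 • p.2 j)) ⁻¹' OddSphere.planDomain ε
  have hA' : ∀ j ε, IsOpen (A' j ε) := by
    intro j ε
    refine ContinuousOn.isOpen_inter_preimage ?_ hZ (OddSphere.isOpen_planDomain ε)
    have hx : Continuous fun p : OddSphereProduct n × OddSphereProduct n => p.1 j.1 := by fun_prop
    have hy : Continuous fun p : OddSphereProduct n × OddSphereProduct n => p.2 j.1 := by fun_prop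
    exact hx.continuousOn.prodMk (hθ.smul hy.continuousOn)
  have hθy : ∀ x y, (x, y) ∈ Z → ∀ (g h : torsionCircle t) j,
      θ (g • x) (h • y) • (h • y) j = (g : Circle) • θ x y • y j := by
    intro x y hxy g h j
    change θ (g • x) (h • y) • (h : Circle) • y j = _
    rw [hθsmul x y hxy, smul_smul, smul_smul, inv_mul_cancel_right]
  have hA'q : ∀ j ε x y, (⟦x⟧, ⟦y⟧) ∈ q '' A' j ε → (x, y) ∈ A' j ε := by
    rintro j ε x y ⟨⟨x', y'⟩, hp, hpq⟩
    obtain ⟨g, rfl⟩ := CPProduct.exists_smul_eq (congrArg Prod.fst hpq).symm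
    obtain ⟨h, rfl⟩ := CPProduct.exists_smul_eq (congrArg Prod.snd hpq).symm
    refine ⟨?_, ?_⟩
    · change q (g • x', h • y') ∈ ZE
      have hZE' : q (x', y') ∈ ZE := hp.1
      rwa [hpq] at hZE'
    · change ((g : Circle) • x' j.1, θ (g • x') (h • y') • (h • y') j.1) ∈ OddSphere.planDomain ε
      rw [hθy x' y' hp.1, OddSphere.smul_mem_planDomain_iff]
      exact hp.2
  have hcov : ∀ j, ZE ⊆ ⋃ ε, q '' A' j ε := by
    intro j p hp
    obtain ⟨⟨x, y⟩, rfl⟩ := hq.surjective p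
    obtain ⟨ε, hε⟩ := OddSphere.exists_mem_planDomain (x j.1, θ x y • y j.1)
    exact mem_iUnion.2 ⟨ε, (x, y), ⟨hp, hε⟩, rfl⟩
  have hplan : ∀ ε : {j : Fin r // j ≠ i} → Fin 2,
      HasMotionPlanner (ZE ∩ ⋂ j, q '' A' j (ε j)) := by
    intro ε
    let δ : Fin r → Fin 2 := fun j => if hj : j ≠ i then ε ⟨j, hj⟩ else 0
    let F : OddSphereProduct n → OddSphereProduct n → I → OddSphereProduct n := fun x y s =>
      Function.update (fun j => OddSphere.plan (δ j) (x j) (θ x y • y j) s) i (w x y s)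
    have hFsmul : ∀ x y, (x, y) ∈ Z → ∀ (g h : torsionCircle t) s,
        F (g • x) (h • y) s = g • F x y s := by
      intro x y hxy g h s
      funext j
      change _ = (g : Circle) • F x y s j
      by_cases hj : j = i
      · subst hj
        simp only [F, Function.update_self]
        exact hwsmul x y hxy g h s
      · simp only [F, Function.update_of_ne hj]
        rw [hθy x y hxy]
        exact OddSphere.plan_smul (δ j) g (x j) (θ x y • y j) s
    have hFq : ∀ x y, (x, y) ∈ Z → ∀ s,
        (⟦F (⟦x⟧ : CPProduct n t).out (⟦y⟧ : CPProduct n t).out s⟧ : CPProduct n t)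
          = ⟦F x y s⟧ := by
      intro x y hxy s
      obtain ⟨g, hg⟩ := CPProduct.exists_smul_eq (Quotient.out_eq (⟦x⟧ : CPProduct n t))
      obtain ⟨h, hh⟩ := CPProduct.exists_smul_eq (Quotient.out_eq (⟦y⟧ : CPProduct n t))
      rw [← hg, ← hh, hFsmul x y hxy, CPProduct.mk_smul]
    refine hasMotionPlanner_of_continuousOn
      (fun p s => ⟦F p.1.out p.2.out s⟧) ?_ ?_ ?_
    · refine (hq.prodMap IsOpenQuotientMap.id).continuousOn_of_comp ?_
      have hF : ContinuousOn (fun p : (OddSphereProduct n × OddSphereProduct n) × I =>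
          (⟦F p.1.1 p.1.2 p.2⟧ : CPProduct n t))
          (Prod.map q id ⁻¹' ((ZE ∩ ⋂ j, q '' A' j (ε j)) ×ˢ univ)) := by
        refine CPProduct.isOpenQuotientMap_mk.continuous.comp_continuousOn
          (continuousOn_pi.2 fun j => ?_)
        by_cases hj : j = i
        · subst hj
          simp only [F, Function.update_self]
          exact hw.mono fun p hp => ⟨hp.1.1, mem_univ _⟩
        · simp only [F, Function.update_of_ne hj]
          refine (OddSphere.continuousOn_plan (δ j)).comp
            (f := fun p : (OddSphereProduct n × OddSphereProduct n) × I =>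
              (p.1.1 j, θ p.1.1 p.1.2 • p.1.2 j, p.2)) ?_ fun p hp => ?_
          · have hx : Continuous fun p : (OddSphereProduct n × OddSphereProduct n) × I =>
                p.1.1 j := by fun_prop
            have hy : Continuous fun p : (OddSphereProduct n × OddSphereProduct n) × I =>
                p.1.2 j := by fun_prop
            have hθ' := hθ.comp (t := Z) (s := Prod.map q id ⁻¹'
              ((ZE ∩ ⋂ j, q '' A' j (ε j)) ×ˢ (univ : Set I))) continuousOn_fst
              fun p hp => hp.1.1
            exact hx.continuousOn.prodMk ((hθ'.smul hy.continuousOn).prodMk continuousOn_snd)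
          · have hmem := (hA'q ⟨j, hj⟩ _ _ _ (mem_iInter.1 hp.1.2 ⟨j, hj⟩)).2
            simpa [δ, hj] using hmem
      refine hF.congr fun p hp => ?_
      exact hFq p.1.1 p.1.2 hp.1.1 p.2
    · intro p hp
      obtain ⟨⟨x, y⟩, rfl⟩ := hq.surjective p
      refine (hFq x y hp.1 0).trans (congrArg _ (funext fun j => ?_))
      by_cases hj : j = i
      · subst hj
        simp only [F, Function.update_self, hw0 x y hp.1]
      · simp only [F, Function.update_of_ne hj, OddSphere.plan_zero]
    · intro p hp
      obtain ⟨⟨x, y⟩, rfl⟩ := hq.surjective p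
      refine (hFq x y hp.1 1).trans ?_
      have hF1 : F x y 1 = θ x y • y := by
        funext j
        change _ = θ x y • y j
        by_cases hj : j = i
        · subst hj
          simp only [F, Function.update_self, hw1 x y hp.1]
        · simp only [F, Function.update_of_ne hj, OddSphere.plan_one]
      rw [hF1]
      exact CPProduct.mk_circle_smul (hθmem x y hp.1) y
  obtain ⟨U, hU, hUcov, hUplan⟩ := exists_cover_hasMotionPlanner
    (fun _ : {j : Fin r // j ≠ i} => 1) hZE (fun j ε => q '' A' j ε)
    (fun j ε => hq.isOpenMap _ (hA' j ε)) hcov hplan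
  have hcard : ∑ _j : {j : Fin r // j ≠ i}, 1 + 1 = r := by
    have := i.pos
    simp
    omega
  let e : Fin r ≃ Fin (∑ _j : {j : Fin r // j ≠ i}, 1 + 1) := finCongr hcard.symm
  refine ⟨fun k => U (e k), fun k => hU _, ?_, fun k => hUplan _⟩
  rw [e.surjective.iUnion_comp U]
  exact hUcov

theorem CPProduct.topComplexity_le (ht : 0 < t) (i : Fin r) {k : ℕ}
    (hk : topComplexity (CPProduct (fun _ : Fin 1 => n i) t) = k) :
    topComplexity (CPProduct n t) ≤ (r * (1 + k) - 1 : ℕ) := by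
  obtain ⟨V, hV, hVcov, hVplan⟩ := exists_cover_of_topComplexity_eq hk
  choose U hU hUcov hUplan using fun j => CPProduct.exists_cover_preimage (n := n) ht i
    (hV j) (hVplan j)
  refine topComplexity_le_of_cover (ι := Fin (k + 1) × Fin r) ?_ (fun p => U p.1 p.2)
    (fun p => hU _ _) (eq_univ_of_forall fun z => ?_) fun p => hUplan _ _
  · have hpos : 0 < r * (1 + k) := Nat.mul_pos i.pos (by omega)
    rw [Fintype.card_prod, Fintype.card_fin, Fintype.card_fin, Nat.sub_add_cancel hpos]
    ring
  · obtain ⟨j, hj⟩ := mem_iUnion.1 (hVcov.symm ▸ mem_univ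
      (Prod.map (CPProduct.proj i) (CPProduct.proj i) z))
    obtain ⟨l, hl⟩ := mem_iUnion.1 (hUcov j hj)
    exact mem_iUnion.2 ⟨(j, l), hl⟩

end Fibration

theorem theorem4p1 (r : ℕ) (hr : 0 < r) (n : Fin r → ℕ) (hn : Monotone n)
    (t : ℕ∞) (ht : 0 < t) :
    topComplexity (CPProduct (fun _ : Fin 1 => n ⟨0, hr⟩) t) ≠ ⊤ ∧
    lsCategory (CPProduct (fun _ : Fin 1 => n ⟨0, hr⟩) t) ≠ ⊤ ∧
    topComplexity (CPProduct n t)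
      ≤ r * (1 + topComplexity (CPProduct (fun _ : Fin 1 => n ⟨0, hr⟩) t)) - 1 ∧
    (r * (1 + topComplexity (CPProduct (fun _ : Fin 1 => n ⟨0, hr⟩) t)) - 1) + (r - 1)
      ≤ 2 * r * (lsCategory (CPProduct (fun _ : Fin 1 => n ⟨0, hr⟩) t) + 1) - 2 := by
  have hcat := CPProduct.lsCategory_ne_top (n := fun _ : Fin 1 => n ⟨0, hr⟩) ht 0
  obtain ⟨c, hc⟩ := ENat.ne_top_iff_exists.1 hcat
  have hle := topComplexity_le_two_mul_lsCategory hc.symm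
  have htc := ne_top_of_le_ne_top (ENat.natCast_ne_top _) hle
  obtain ⟨k, hk⟩ := ENat.ne_top_iff_exists.1 htc
  have hkc : k ≤ 2 * c := by
    rw [← hk] at hle
    exact_mod_cast hle
  refine ⟨htc, hcat, ?_, ?_⟩
  · have h := CPProduct.topComplexity_le (n := n) ht ⟨0, hr⟩ hk.symm
    rw [← hk]
    exact_mod_cast h
  · rw [← hk, ← hc]
    have h : (r * (1 + k) - 1) + (r - 1) ≤ 2 * r * (c + 1) - 2 := by
      have hmul : r * k ≤ r * (2 * c) := Nat.mul_le_mul_left r hkc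
      have h1 : r * (1 + k) = r + r * k := by ring
      have h2 : 2 * r * (c + 1) = r * (2 * c) + 2 * r := by ring
      omega
    exact_mod_cast h
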